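/- Let $\mathbb K$ be a (commutative) field and let $U$, $V$ be finite-dimensional vector spaces over $\mathbb K$. Let $n\ge 3$ be an integer with $\#\mathbb K>n$, and let $\mathcal T$ be an $n$-dimensional linear subspace of the space $\mathcal L(U,V)$ of linear operators from $U$ to $V$. Assume that: - $\mathcal T$ is reduced, i.e. $\bigcap_{f\in\mathcal T}\ker f=\{0\}$ and $\sum_{f\in\mathcal T}\operatorname{im} f=V$; - $\mathcal T$ is not (algebraically) reflexive, i.e. there is an operator $g\in\mathcal L(U,V)\setminus\mathcal T$ such that $g(x)\in\{f(x)\mid f\in\mathcal T\}$ for every $x\in U$; - every non-zero operator in $\mathcal T$ has rank at least $2n-2$. Then there is an $(n-1)$-dimensional LDB division algebra $(A,\star,\bullet)$ over $\mathbb K$ such that $\mathcal T$ is equivalent to a linear hyperplane of the twisted operator space $\mathcal T_{A,\star,\bullet}$. Here an LDB (left-division-bilinearizable) division algebra over $\mathbb K$ is a triple $(A,\star,\bullet)$ in which $A$ is a $\mathbb K$-vector space of finite positive dimension and $\star,\bullet:A\times A\to A$ are bilinear maps such that $a\star b\ne 0$ whenever $a\neq 0$ and $b\ne 0$; $x\bullet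 y=0$ if and only if $x=0$ or $y=0$; and the vectors $x\star(x\bullet y)$ and $y$ are linearly dependent for all $(x,y)\in A^2$. Its twisted operator space $\mathcal T_{A,\star,\bullet}$ is the space of all endomorphisms of $A^2$ of the form $(y,z)\mapsto(x\star z+\lambda y,\;x\bullet y+\mu z)$ with $(x,\lambda,\mu)\in A\times\mathbb K^2$. A linear hyperplane is a linear subspace of codimension $1$. Two operator spaces $\mathcal S\subset\mathcal L(U,V)$ and $\mathcal S'\subset\mathcal L(U',V')$ are equivalent when there are linear isomorphisms $F:U\to U'$ and $G:V'\to V$ with $\mathcal S=\{G\circ g\circ F\mid g\in\mathcal S'\}$. -/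

import Mathlib

universe u v w v' w'

namespace OperatorSpace

section Operators

variable {K : Type u} [Field K]
variable {U : Type v} [AddCommGroup U] [Module K U] {V : Type w} [AddCommGroup V] [Module K V]
variable {U' : Type v'} [AddCommGroup U'] [Module K U']
variable {V' : Type w'} [AddCommGroup V'] [Module K V']

/-- The kernel of an operator space: the vectors at which all its operators vanish. -/
def kernel (S : Submodule K (U →ₗ[K] V)) : Submodule K U :=
  ⨅ f ∈ S, LinearMap.ker f

/-- The essential range of an operator space: the sum of the ranges of its operators. -/
def essentialRange (S : Submodule K (U →ₗ[K] V)) : Submodule K V :=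
  ⨆ f ∈ S, LinearMap.range f

/-- An operator space is reduced when its kernel is zero and its essential range is the whole
target space. -/
def IsReduced (S : Submodule K (U →ₗ[K] V)) : Prop :=
  kernel S = ⊥ ∧ essentialRange S = ⊤

/-- The reflexive closure of `S`: the operators `g` such that `g x` lies in
`S x = {f x | f ∈ S}` for every vector `x`. -/
def reflexiveClosure (S : Submodule K (U →ₗ[K] V)) : Submodule K (U →ₗ[K] V) where
  carrier := {g | ∀ x : U, ∃ f ∈ S, f x = g x}
  zero_mem' := fun x => ⟨0, S.zero_mem, rfl⟩
  add_mem' := by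
    intro g h hg hh x
    obtain ⟨f₁, hf₁, e₁⟩ := hg x
    obtain ⟨f₂, hf₂, e₂⟩ := hh x
    exact ⟨f₁ + f₂, S.add_mem hf₁ hf₂, by simp [e₁, e₂]⟩
  smul_mem' := by
    intro c g hg x
    obtain ⟨f, hf, e⟩ := hg x
    exact ⟨c • f, S.smul_mem c hf, by simp [e]⟩

/-- An operator space is (algebraically) reflexive when it equals its reflexive closure. -/
def IsReflexive (S : Submodule K (U →ₗ[K] V)) : Prop :=
  S = reflexiveClosure S

/-- Equivalence of operator spaces: `S = {G ∘ g ∘ F | g ∈ S'}` for some linear isomorphisms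
`F : U ≃ U'` and `G : V' ≃ V`. -/
def Equivalent (S : Submodule K (U →ₗ[K] V)) (S' : Submodule K (U' →ₗ[K] V')) : Prop :=
  ∃ (F : U ≃ₗ[K] U') (G : V' ≃ₗ[K] V), ∀ f : U →ₗ[K] V,
    f ∈ S ↔ ∃ g ∈ S', f = G.toLinearMap ∘ₗ g ∘ₗ F.toLinearMap

/-- `H` is a (linear) hyperplane of `S`: a linear subspace of `S` of codimension one in `S`. -/
def IsHyperplaneOf (H S : Submodule K (U →ₗ[K] V)) : Prop :=
  H ≤ S ∧ Module.finrank K (S ⧸ H.submoduleOf S) = 1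

end Operators

section LDB

variable {K : Type u} [Field K] {A : Type v} [AddCommGroup A] [Module K A]

/-- A bilinear map `A × A → A` is regular when the product of two non-zero vectors is non-zero. -/
def IsRegular (star : A →ₗ[K] A →ₗ[K] A) : Prop :=
  ∀ a b : A, a ≠ 0 → b ≠ 0 → star a b ≠ 0

/-- A quasi-left-inversion of `star`: a binary operation `bullet` on `A` which vanishes exactly on
`(A × {0}) ∪ ({0} × A)`, and such that `star x (bullet x y)` and `y` are collinear
(that is, linearly dependent) for all `x` and `y`. -/
def IsQuasiLeftInversion (star : A →ₗ[K] A →ₗ[K] A) (bullet : A → A → A) : Prop :=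
  (∀ x y : A, bullet x y = 0 ↔ x = 0 ∨ y = 0) ∧
    ∀ x y : A, ¬ LinearIndependent K ![star x (bullet x y), y]

/-- `(A, star, bullet)` is a left-division-bilinearizable (LDB) division algebra: `A` is a
finite-dimensional vector space of positive dimension, `star` is a regular bilinear map, and
`bullet` is a bilinear quasi-left-inversion of `star`. -/
structure IsLDBDivisionAlgebra (star bullet : A →ₗ[K] A →ₗ[K] A) : Prop where
  finiteDimensional : FiniteDimensional K A
  nontrivial : Nontrivial A
  regular : IsRegular star
  quasiLeftInversion : IsQuasiLeftInversion star (fun x y => bullet x y)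

/-- The bilinear map `(x + (s, t), (y, z)) ↦ (star x z + s y, bullet x y + t z)` from
`(A ⊕ K²) × A²` to `A²`, as a linear map from `A ⊕ K²` to the endomorphisms of `A²`. -/
def twistedMap (star bullet : A →ₗ[K] A →ₗ[K] A) :
    (A × K × K) →ₗ[K] (A × A) →ₗ[K] (A × A) :=
  LinearMap.mk₂ K
    (fun p q => (star p.1 q.2 + p.2.1 • q.1, bullet p.1 q.1 + p.2.2 • q.2))
    (by
      intro p p' q
      ext <;> simp [add_smul] <;> abel)
    (by
      intro c p q
      ext <;> simp [mul_smul])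
    (by
      intro p q q'
      ext <;> simp <;> abel)
    (by
      intro c p q
      ext <;> simp [smul_comm c])

/-- The twisted operator space attached to `(A, star, bullet)`: all the endomorphisms
`(y, z) ↦ (star x z + s y, bullet x y + t z)` of `A²`, for `x` in `A` and `s`, `t` in `K`. -/
def twistedOperatorSpace (star bullet : A →ₗ[K] A →ₗ[K] A) :
    Submodule K ((A × A) →ₗ[K] (A × A)) :=
  LinearMap.range (twistedMap star bullet)

end LDB

end OperatorSpace

/-!
Let `n = dim T`. The operators of maximal rank in a pencil `M + c N` send chains `M s₀ = 0`,
`M sᵢ₊₁ = N sᵢ` into their own range, as soon as `K` has more elements than that rank. Applied to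
the evaluations `t ↦ t x` this produces a separating vector `x` of `T`, and shows that an operator
`f` of the reflexive closure of `T` with `f x = 0` has range in `T x = {t x | t ∈ T}`.

If `g` witnesses the failure of reflexivity, the coset `g + T` contains two different operators `f`
and `h` that vanish at separating vectors `x` and `y` of `T`. Since `f - h` has rank at least
`2 n - 2`, while the ranks of `f` and `h` are at most `n` and cannot be `n`, both ranks are `n - 1`
and the ranges are independent; as `T` is reduced, the ranges are complementary in `V` and the
kernels complementary in `U`. In coordinates adapted to these decompositions `f` and `h` are the
two diagonal idempotents, and the operators of `T + K f` with no diagonal part map each of the two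
kernels onto the range of the same operator: their two blocks are the products `⋆` and `•`.
Finally `T + K f` has no separating vector, because `f` agrees with an operator of `T` at every
vector, and this is what makes `•` a quasi-left-inversion of `⋆`.
-/

namespace OperatorSpace

open Module

section Pencil

variable {K : Type u} [Field K] {V : Type w} [AddCommGroup V] [Module K V]

lemma exists_injective_add_smul {P : Type v} [AddCommGroup P] [Module K P] [FiniteDimensional K P]
    (hK : (finrank K P : Cardinal.{u}) < Cardinal.mk K) {M N : P →ₗ[K] V}
    (hM : Function.Injective M) (hN : ¬ Function.Injective N) :
    ∃ c : K, c ≠ 0 ∧ Function.Injective (M + c • N) := by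
  obtain ⟨φ, hφ⟩ := LinearMap.exists_leftInverse_of_injective M (LinearMap.ker_eq_bot.2 hM)
  obtain ⟨d, hd⟩ := Polynomial.exists_eval_ne_zero_of_natDegree_lt_card (φ ∘ₗ N).charpoly
    (LinearMap.charpoly_monic _).ne_zero (by rwa [LinearMap.charpoly_natDegree])
  have heigen : ∀ p, φ (N p) = d • p → p = 0 := by
    intro p hp
    by_contra hp0
    refine hd ((End.hasEigenvalue_iff_isRoot_charpoly _ _).1 ?_)
    exact End.hasEigenvalue_of_hasEigenvector ⟨End.mem_eigenspace_iff.2 hp, hp0⟩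
  have hd0 : d ≠ 0 := by
    rintro rfl
    refine hN ((injective_iff_map_eq_zero N).2 fun p hp => heigen p ?_)
    rw [hp, map_zero, zero_smul]
  refine ⟨-d⁻¹, neg_ne_zero.2 (inv_ne_zero hd0),
    (injective_iff_map_eq_zero _).2 fun p hp => heigen p ?_⟩
  have hpM : φ (M p) = p := LinearMap.congr_fun hφ p
  have hMN : M p = d⁻¹ • N p := by simpa [add_neg_eq_zero] using hp
  have hNM : N p = d • M p := by rw [hMN, smul_inv_smul₀ hd0]
  rw [hNM, map_smul, hpM]

lemma finrank_lt_finrank_of_injective_mkQ {P : Type v} [AddCommGroup P] [Module K P]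
    {R : Submodule K V} [FiniteDimensional K R] {g : P →ₗ[K] V} {q : V} (hq0 : q ≠ 0)
    (hq : q ∈ R) (hgR : LinearMap.range g ≤ R) (hg : Function.Injective ((K ∙ q).mkQ ∘ₗ g)) :
    finrank K P < finrank K R := by
  have hqg : q ∉ LinearMap.range g := by
    rintro ⟨p, rfl⟩
    refine hq0 ?_
    rw [hg (a₁ := p) (a₂ := 0) (by simp), map_zero]
  calc finrank K P = finrank K (LinearMap.range g) :=
        (LinearMap.finrank_range_of_inj (Function.Injective.of_comp hg)).symm
    _ < finrank K R := Submodule.finrank_lt_finrank_of_lt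
        (lt_of_le_of_ne hgR fun h => hqg (h ▸ hq))

variable {S : Type v} [AddCommGroup S] [Module K S]

lemma smul_apply_mem_range_add_smul {M N : S →ₗ[K] V} {s : ℕ → S} {k : ℕ} (h0 : M (s 0) = 0)
    (hs : ∀ i < k, M (s (i + 1)) = N (s i)) (c : K) :
    (c * (-c) ^ k) • N (s k) ∈ LinearMap.range (M + c • N) := by
  suffices h : ∀ j ≤ k, (M + c • N) (∑ i ∈ Finset.range (j + 1), (-c) ^ i • s i)
      = (c * (-c) ^ j) • N (s j) from ⟨_, h k le_rfl⟩
  intro j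
  induction j with
  | zero => simp [h0]
  | succ j ih =>
    intro hj
    rw [Finset.sum_range_succ, map_add, ih (by omega)]
    simp only [map_smul, LinearMap.add_apply, LinearMap.smul_apply, hs j (by omega)]
    module

/-- If `N sₖ` were not in the range of `M`, the map `M` would stay injective modulo `N sₖ` on a
complement of its kernel, and so would some `M + c N` with `c ≠ 0`. But the chain puts `N sₖ` into
the range of `M + c N`, whose rank would then exceed that of `M`. -/
lemma apply_mem_range_of_chain [FiniteDimensional K S] {M N : S →ₗ[K] V}
    (hK : (finrank K (LinearMap.range M) : Cardinal.{u}) < Cardinal.mk K)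
    (hN : finrank K (LinearMap.range N) ≤ finrank K (LinearMap.range M))
    (hMN : ∀ c : K, finrank K (LinearMap.range (M + c • N)) ≤ finrank K (LinearMap.range M))
    {s : ℕ → S} {k : ℕ} (h0 : M (s 0) = 0) (hs : ∀ i < k, M (s (i + 1)) = N (s i)) :
    N (s k) ∈ LinearMap.range M := by
  by_contra hq
  have hq0 : N (s k) ≠ 0 := fun h => hq (h ▸ Submodule.zero_mem _)
  obtain ⟨e, he⟩ := M.rangeRestrict.exists_rightInverse_of_surjective M.range_rangeRestrict
  have hMe : M ∘ₗ e = (LinearMap.range M).subtype :=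
    LinearMap.ext fun v => congrArg Subtype.val (LinearMap.congr_fun he v)
  have hinj : Function.Injective ((K ∙ N (s k)).mkQ ∘ₗ M ∘ₗ e) := by
    rw [hMe, ← LinearMap.ker_eq_bot, LinearMap.ker_comp, Submodule.ker_mkQ,
      ← Submodule.disjoint_iff_comap_eq_bot]
    exact (Submodule.disjoint_span_singleton' hq0).2 hq
  have hmod : ∀ L : S →ₗ[K] V, finrank K (LinearMap.range L) ≤ finrank K (LinearMap.range M) →
      N (s k) ∈ LinearMap.range L → ¬ Function.Injective ((K ∙ N (s k)).mkQ ∘ₗ L ∘ₗ e) :=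
    fun L hL hmem hLe => hL.not_gt
      (finrank_lt_finrank_of_injective_mkQ hq0 hmem (LinearMap.range_comp_le_range _ _) hLe)
  obtain ⟨c, hc, hMNc⟩ :=
    exists_injective_add_smul hK hinj (hmod N hN (LinearMap.mem_range_self N _))
  refine hmod (M + c • N) (hMN c) ?_ (by
    simpa only [LinearMap.add_comp, LinearMap.comp_add, LinearMap.smul_comp, LinearMap.comp_smul]
      using hMNc)
  exact (Submodule.smul_mem_iff _ (mul_ne_zero hc (pow_ne_zero k (neg_ne_zero.2 hc)))).1
    (smul_apply_mem_range_add_smul h0 hs c)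

end Pencil

section Orbit

variable {K : Type u} [Field K] {U : Type v} [AddCommGroup U] [Module K U]
  {V : Type w} [AddCommGroup V] [Module K V] {S T : Submodule K (U →ₗ[K] V)}
  {s t : U →ₗ[K] V} {x : U}

lemma le_reflexiveClosure (T : Submodule K (U →ₗ[K] V)) : T ≤ reflexiveClosure T :=
  fun t ht _ => ⟨t, ht, rfl⟩

/-- Evaluation of the operators of `T` at the vector `x`: an operator of the space dual to `T`. -/
def evalAt (T : Submodule K (U →ₗ[K] V)) (x : U) : T →ₗ[K] V :=
  (LinearMap.applyₗ x).domRestrict T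

@[simp]
lemma evalAt_apply (T : Submodule K (U →ₗ[K] V)) (x : U) (t : T) :
    evalAt T x t = (t : U →ₗ[K] V) x := rfl

lemma evalAt_add_smul (T : Submodule K (U →ₗ[K] V)) (x y : U) (c : K) :
    evalAt T (x + c • y) = evalAt T x + c • evalAt T y :=
  LinearMap.ext fun t => by simp

/-- The space `T x = {t x | t ∈ T}` of the values at `x` of the operators of `T`. -/
def orbit (T : Submodule K (U →ₗ[K] V)) (x : U) : Submodule K V :=
  LinearMap.range (evalAt T x)

lemma mem_orbit {v : V} : v ∈ orbit T x ↔ ∃ t ∈ T, t x = v := by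
  simp [orbit]

lemma apply_mem_orbit (ht : t ∈ T) (x : U) : t x ∈ orbit T x :=
  mem_orbit.2 ⟨t, ht, rfl⟩

lemma orbit_le_iff {N : Submodule K V} : orbit T x ≤ N ↔ ∀ t ∈ T, t x ∈ N :=
  ⟨fun h t ht => h (apply_mem_orbit ht x), fun h _ hv => by
    obtain ⟨t, ht, rfl⟩ := mem_orbit.1 hv
    exact h t ht⟩

lemma orbit_eq_of_le_reflexiveClosure (hTS : T ≤ S) (hST : S ≤ reflexiveClosure T) (x : U) :
    orbit S x = orbit T x :=
  le_antisymm (orbit_le_iff.2 fun _ hs => mem_orbit.2 (hST hs x))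
    (orbit_le_iff.2 fun _ ht => apply_mem_orbit (hTS ht) x)

lemma exists_linearMap_apply_eq_apply {f : U →ₗ[K] V} (hf : orbit T x ≤ LinearMap.range f) :
    ∃ g : T →ₗ[K] U, ∀ t : T, f (g t) = (t : U →ₗ[K] V) x := by
  obtain ⟨g, hg⟩ := Module.projective_lifting_property f.rangeRestrict
    ((evalAt T x).codRestrict (LinearMap.range f) fun t => hf (LinearMap.mem_range_self _ t))
    f.surjective_rangeRestrict
  exact ⟨g, fun t => congrArg Subtype.val (LinearMap.congr_fun hg t)⟩

/-- A separating vector of `T`: one at which the operators of `T` take pairwise distinct values. -/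
def IsSeparatingVector (T : Submodule K (U →ₗ[K] V)) (x : U) : Prop :=
  Function.Injective (evalAt T x)

lemma IsSeparatingVector.eq (hx : IsSeparatingVector T x) (hs : s ∈ T) (ht : t ∈ T)
    (h : s x = t x) : s = t :=
  congrArg Subtype.val (hx (a₁ := ⟨s, hs⟩) (a₂ := ⟨t, ht⟩) h)

lemma IsSeparatingVector.eq_zero (hx : IsSeparatingVector T x) (ht : t ∈ T) (h : t x = 0) :
    t = 0 :=
  hx.eq ht T.zero_mem (by rw [h, LinearMap.zero_apply])

lemma isSeparatingVector_iff : IsSeparatingVector T x ↔ ∀ t ∈ T, t x = 0 → t = 0 := by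
  simp [IsSeparatingVector, injective_iff_map_eq_zero]

lemma IsSeparatingVector.finrank_orbit (hx : IsSeparatingVector T x) :
    finrank K (orbit T x) = finrank K T :=
  LinearMap.finrank_range_of_inj hx

section FiniteDimensional

variable [FiniteDimensional K T]

instance : FiniteDimensional K (orbit T x) :=
  inferInstanceAs (FiniteDimensional K (LinearMap.range (evalAt T x)))

lemma finrank_orbit_le (T : Submodule K (U →ₗ[K] V)) [FiniteDimensional K T] (x : U) :
    finrank K (orbit T x) ≤ finrank K T :=
  LinearMap.finrank_range_le _

lemma exists_finrank_orbit_le (T : Submodule K (U →ₗ[K] V)) [FiniteDimensional K T] :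
    ∃ x, ∀ y, finrank K (orbit T y) ≤ finrank K (orbit T x) := by
  obtain ⟨_, ⟨x, rfl⟩, hx⟩ := BddAbove.exists_isGreatest_of_nonempty
    (S := Set.range fun x => finrank K (orbit T x))
    ⟨finrank K T, by rintro _ ⟨x, rfl⟩; exact finrank_orbit_le T x⟩ (Set.range_nonempty _)
  exact ⟨x, fun y => hx ⟨y, rfl⟩⟩

/-- Since `t₀ x = 0`, the operators `t₀, t₁, …` form a chain of the pencil spanned by the
evaluations at `x` and `y`. -/
lemma chain_mem_orbit (hK : (finrank K (orbit T x) : Cardinal.{u}) < Cardinal.mk K)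
    (hmax : ∀ y, finrank K (orbit T y) ≤ finrank K (orbit T x))
    {t : ℕ → U →ₗ[K] V} (ht : ∀ i, t i ∈ T) {y : U} {k : ℕ} (h0 : t 0 x = 0)
    (hchain : ∀ i < k, t (i + 1) x = t i y) : t k y ∈ orbit T x :=
  apply_mem_range_of_chain (M := evalAt T x) (N := evalAt T y) hK (hmax y)
    (fun c => by rw [← evalAt_add_smul]; exact hmax _) (s := fun i => ⟨t i, ht i⟩) h0 hchain

lemma exists_isSeparatingVector (hK : (finrank K T : Cardinal.{u}) < Cardinal.mk K)
    (hrank : ∀ t ∈ T, t ≠ 0 → finrank K T ≤ finrank K (LinearMap.range t)) :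
    ∃ x, IsSeparatingVector T x := by
  obtain ⟨x, hx⟩ := exists_finrank_orbit_le T
  have hKx : (finrank K (orbit T x) : Cardinal.{u}) < Cardinal.mk K :=
    lt_of_le_of_lt (by exact_mod_cast finrank_orbit_le T x) hK
  refine ⟨x, isSeparatingVector_iff.2 fun t ht htx => ?_⟩
  by_contra ht0
  have hrange : LinearMap.range t ≤ orbit T x := by
    rintro _ ⟨y, rfl⟩
    exact chain_mem_orbit hKx hx (t := fun _ => t) (fun _ => ht) (k := 0) htx (by simp)
  have horbit : finrank K (orbit T x) = finrank K T :=
    le_antisymm (finrank_orbit_le T x) ((hrank t ht ht0).trans (Submodule.finrank_mono hrange))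
  have hsep : IsSeparatingVector T x := by
    refine LinearMap.ker_eq_bot.1 (Submodule.finrank_eq_zero.1 ?_)
    have hrn := LinearMap.finrank_range_add_finrank_ker (evalAt T x)
    rw [← orbit] at hrn
    omega
  exact ht0 (hsep.eq_zero ht htx)

lemma IsSeparatingVector.exists_add_smul (hK : (finrank K T : Cardinal.{u}) < Cardinal.mk K)
    {y : U} (hx : IsSeparatingVector T x) (hy : ¬ IsSeparatingVector T y) :
    ∃ c : K, c ≠ 0 ∧ IsSeparatingVector T (x + c • y) := by
  simp only [IsSeparatingVector, evalAt_add_smul]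
  exact exists_injective_add_smul hK hx hy

end FiniteDimensional

end Orbit

section Dimension

variable {K : Type u} [Field K] {U : Type v} [AddCommGroup U] [Module K U] [FiniteDimensional K U]
  {V : Type w} [AddCommGroup V] [Module K V]

lemma finrank_map_add_finrank_inf_ker (t : U →ₗ[K] V) (B : Submodule K U) :
    finrank K (B.map t) + finrank K (B ⊓ LinearMap.ker t : Submodule K U) = finrank K B := by
  rw [← LinearMap.finrank_range_add_finrank_ker (t.domRestrict B), LinearMap.range_domRestrict,
    LinearMap.ker_domRestrict, ← Submodule.map_comap_subtype, Submodule.finrank_map_subtype_eq]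

lemma finrank_range_add_finrank_le (t : U →ₗ[K] V) (B : Submodule K U) :
    finrank K (LinearMap.range t) + finrank K B ≤ finrank K U + finrank K (B.map t) := by
  have hU := LinearMap.finrank_range_add_finrank_ker t
  have hB := finrank_map_add_finrank_inf_ker t B
  have hker : finrank K (B ⊓ LinearMap.ker t : Submodule K U) ≤ finrank K (LinearMap.ker t) :=
    Submodule.finrank_mono inf_le_right
  omega

lemma finrank_range_sub_le (f h : U →ₗ[K] V) : finrank K (LinearMap.range (f - h)) ≤
    finrank K (LinearMap.range f ⊔ LinearMap.range h : Submodule K V) := by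
  refine Submodule.finrank_mono ?_
  rintro _ ⟨z, rfl⟩
  exact sub_mem (Submodule.mem_sup_left ⟨z, rfl⟩) (Submodule.mem_sup_right ⟨z, rfl⟩)

lemma exists_ne_zero_map_eq_zero_of_isAlt (hU : finrank K U = 3) {B : U →ₗ[K] U →ₗ[K] V}
    (hB : B.IsAlt) (hrank : ∀ u, finrank K (LinearMap.range (B u)) ≤ 1) :
    ∃ v, v ≠ 0 ∧ B v = 0 := by
  by_cases hB0 : B = 0
  · have : Nontrivial U := nontrivial_of_finrank_pos (R := K) (by omega)
    obtain ⟨v, hv⟩ := exists_ne (0 : U)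
    exact ⟨v, hv, by rw [hB0, LinearMap.zero_apply]⟩
  obtain ⟨y, r, hyr⟩ : ∃ y r, B y r ≠ 0 := by
    by_contra! h
    exact hB0 (LinearMap.ext₂ h)
  obtain ⟨v, hvker, hv⟩ :
      ∃ v ∈ (LinearMap.ker (B y) ⊓ LinearMap.ker (B r) : Submodule K U), v ≠ 0 := by
    refine Submodule.exists_mem_ne_zero_of_ne_bot fun h => ?_
    have hsum :=
      Submodule.finrank_sup_add_finrank_inf_eq (LinearMap.ker (B y)) (LinearMap.ker (B r))
    have hle := Submodule.finrank_le (LinearMap.ker (B y) ⊔ LinearMap.ker (B r))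
    have hy := LinearMap.finrank_range_add_finrank_ker (B y)
    have hr := LinearMap.finrank_range_add_finrank_ker (B r)
    have := hrank y
    have := hrank r
    rw [h, finrank_bot] at hsum
    omega
  obtain ⟨hyv, hrv⟩ : B y v = 0 ∧ B r v = 0 := hvker
  have hli : LinearIndependent K ![y, r, v] := by
    refine Fintype.linearIndependent_iff.2 fun a ha => ?_
    simp only [Fin.sum_univ_three, Matrix.cons_val] at ha
    have hr : a 1 = 0 := by simpa [hB y, hyv, hyr] using congrArg (B y) ha
    have hy : a 0 = 0 := by
      simpa [hB r, hrv, ← hB.neg y r, hyr] using congrArg (B r) ha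
    have hv' : a 2 = 0 := by simpa [hr, hy, hv] using ha
    simp [Fin.forall_fin_succ, hr, hy, hv']
  refine ⟨v, hv, LinearMap.ext_on_range (hli.span_eq_top_of_card_eq_finrank' (by simp [hU])) ?_⟩
  intro i
  fin_cases i
  · simpa [hyv] using (hB.neg y v).symm
  · simpa [hrv] using (hB.neg r v).symm
  · simpa using hB v

end Dimension

section Annihilator

variable {K : Type u} [Field K] {U : Type v} [AddCommGroup U] [Module K U]
  {V : Type w} [AddCommGroup V] [Module K V] {T : Submodule K (U →ₗ[K] V)} {x : U} {f : U →ₗ[K] V}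

/-- `f` is an annihilator of `x` over `T`: an operator of the reflexive closure of `T` that vanishes
at the separating vector `x` of `T`. -/
structure IsAnnihilator (T : Submodule K (U →ₗ[K] V)) (x : U) (f : U →ₗ[K] V) : Prop where
  separating : IsSeparatingVector T x
  mem_reflexiveClosure : f ∈ reflexiveClosure T
  apply_eq_zero : f x = 0

namespace IsAnnihilator

section Chains

variable [FiniteDimensional K T] (hf : IsAnnihilator T x f)
  (hK : (finrank K T : Cardinal.{u}) < Cardinal.mk K) {y z : U} {r s t : U →ₗ[K] V}

include hf hK

lemma chain_mem_orbit {t : ℕ → U →ₗ[K] V} {k : ℕ} (h0 : t 0 = f)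
    (ht : ∀ i, t (i + 1) ∈ T) (hchain : ∀ i < k, t (i + 1) x = t i y) : t k y ∈ orbit T x := by
  have hST : T ⊔ (K ∙ f) ≤ reflexiveClosure T :=
    sup_le (le_reflexiveClosure T)
      ((Submodule.span_singleton_le_iff_mem _ _).2 hf.mem_reflexiveClosure)
  have horbit := orbit_eq_of_le_reflexiveClosure le_sup_left hST
  rw [← horbit]
  refine OperatorSpace.chain_mem_orbit ?_ (fun z => ?_) (fun i => ?_) (h0 ▸ hf.apply_eq_zero) hchain
  · rwa [horbit, hf.separating.finrank_orbit]
  · rw [horbit, horbit, hf.separating.finrank_orbit]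
    exact finrank_orbit_le T z
  · cases i with
    | zero => exact Submodule.mem_sup_right (h0 ▸ Submodule.mem_span_singleton_self _)
    | succ i => exact Submodule.mem_sup_left (ht i)

lemma range_le_orbit : LinearMap.range f ≤ orbit T x := by
  rintro _ ⟨y, rfl⟩
  exact hf.chain_mem_orbit hK (t := fun | 0 => f | _ + 1 => 0) (k := 0) rfl
    (fun _ => T.zero_mem) (by simp)

lemma apply_mem_orbit (ht : t ∈ T) (hty : t x = f y) : t y ∈ orbit T x :=
  hf.chain_mem_orbit hK (t := fun | 0 => f | _ + 1 => t) (k := 1) rfl (fun _ => ht) (by simpa)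

lemma apply_mem_orbit_of_chain (ht : t ∈ T) (hs : s ∈ T) (hty : t x = f y) (hsy : s x = t y) :
    s y ∈ orbit T x :=
  hf.chain_mem_orbit hK (t := fun | 0 => f | 1 => t | _ + 2 => s) (k := 2) rfl
    (fun i => by cases i <;> simpa) (fun i hi => by
      obtain rfl | rfl : i = 0 ∨ i = 1 := by omega
      · simpa
      · simpa)

lemma add_mem_orbit (ht : t ∈ T) (hs : s ∈ T) (hty : t x = f y) (hsz : s x = f z) :
    t z + s y ∈ orbit T x := by
  have hsum := hf.apply_mem_orbit hK (T.add_mem ht hs) (y := y + z) (by simp [hty, hsz])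
  have hpolar : t z + s y = (t + s) (y + z) - t y - s z := by
    simp only [LinearMap.add_apply, map_add]
    abel
  rw [hpolar]
  exact sub_mem (sub_mem hsum (hf.apply_mem_orbit hK ht hty)) (hf.apply_mem_orbit hK hs hsz)

lemma apply_mem_orbit_iff (ht : t ∈ T) (hs : s ∈ T) (hty : t x = f y) (hsz : s x = f z) :
    t z ∈ orbit T x ↔ s y ∈ orbit T x :=
  have hadd := hf.add_mem_orbit hK ht hs hty hsz
  ⟨fun h => (Submodule.add_mem_iff_right _ h).1 hadd,
    fun h => (Submodule.add_mem_iff_left _ h).1 hadd⟩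

lemma apply_ker_mem_orbit (ht : t ∈ T) (htx : t x ∈ LinearMap.range f) (hz : f z = 0) :
    t z ∈ orbit T x := by
  obtain ⟨y, hy⟩ := htx
  exact (hf.apply_mem_orbit_iff hK ht T.zero_mem hy.symm (by simp [hz])).2 (Submodule.zero_mem _)

lemma add_smul_mem_orbit_of_chain (ht : t ∈ T) (hs : s ∈ T) (hr : r ∈ T) (hty : t x = f y)
    (hz : f z = 0) (hsy : s x = t y) (hrz : r x = t z) {c : K} (hc : c ≠ 0) :
    (r y + s z) + c • r z ∈ orbit T x := by
  have hsum := hf.apply_mem_orbit_of_chain hK ht (T.add_mem hs (T.smul_mem c hr)) (y := y + c • z)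
    (by simp [hty, hz]) (by simp [hsy, hrz])
  have hdiff := sub_mem hsum (hf.apply_mem_orbit_of_chain hK ht hs hty hsy)
  refine (Submodule.smul_mem_iff _ hc).1 ?_
  convert hdiff using 1
  simp only [LinearMap.add_apply, map_add, LinearMap.smul_apply, map_smul]
  module

lemma apply_ker_mem_orbit_of_chain (h2 : 2 ≤ finrank K T) (ht : t ∈ T) (hs : s ∈ T) (hr : r ∈ T)
    (hty : t x = f y) (hz : f z = 0) (hsy : s x = t y) (hrz : r x = t z) :
    r z ∈ orbit T x := by
  obtain ⟨c, hc⟩ := Cardinal.exists_notMem_of_length_lt [(0 : K), 1]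
    (lt_of_le_of_lt (by simpa using h2) hK)
  simp only [List.mem_cons, List.not_mem_nil, or_false, not_or] at hc
  have h1 := hf.add_smul_mem_orbit_of_chain hK ht hs hr hty hz hsy hrz one_ne_zero
  have hcO := hf.add_smul_mem_orbit_of_chain hK ht hs hr hty hz hsy hrz hc.1
  refine (Submodule.smul_mem_iff _ (sub_ne_zero.2 hc.2)).1 ?_
  convert sub_mem hcO h1 using 1
  module

lemma add_mem_orbit_of_chain (h2 : 2 ≤ finrank K T) (ht : t ∈ T) (hs : s ∈ T) (hr : r ∈ T)
    (hty : t x = f y) (hz : f z = 0) (hsy : s x = t y) (hrz : r x = t z) :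
    r y + s z ∈ orbit T x := by
  have h1 := hf.add_smul_mem_orbit_of_chain hK ht hs hr hty hz hsy hrz one_ne_zero
  rw [one_smul] at h1
  exact (Submodule.add_mem_iff_left _
    (hf.apply_ker_mem_orbit_of_chain hK h2 ht hs hr hty hz hsy hrz)).1 h1

end Chains

section Ranks

variable [FiniteDimensional K T] (hf : IsAnnihilator T x f)
  (hK : (finrank K T : Cardinal.{u}) < Cardinal.mk K) {y : U} {s t : U →ₗ[K] V}

include hf hK

lemma ker_le_comap_orbit (ht : t ∈ T) (htx : t x ∈ LinearMap.range f) :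
    LinearMap.ker f ≤ (orbit T x).comap t :=
  fun _ hz => hf.apply_ker_mem_orbit hK ht htx hz

lemma ker_sup_span_le_comap_orbit (ht : t ∈ T) (hty : t x = f y) :
    LinearMap.ker f ⊔ (K ∙ y) ≤ (orbit T x).comap t :=
  sup_le (hf.ker_le_comap_orbit hK ht ⟨y, hty.symm⟩)
    ((Submodule.span_singleton_le_iff_mem _ _).2 (hf.apply_mem_orbit hK ht hty))

lemma map_ker_sup_span_le (h2 : 2 ≤ finrank K T) (hrange : LinearMap.range f = orbit T x)
    (ht : t ∈ T) (hty : t x = f y) :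
    (LinearMap.ker f ⊔ (K ∙ y)).map t ≤ ((orbit T x).comap t).map f := by
  have hmap : ∀ r ∈ T, r y ∈ orbit T x → r x ∈ ((orbit T x).comap t).map f := by
    intro r hr hry
    obtain ⟨w, hw⟩ : r x ∈ LinearMap.range f := hrange ▸ OperatorSpace.apply_mem_orbit hr x
    exact ⟨w, (hf.apply_mem_orbit_iff hK ht hr hty hw.symm).2 hry, hw⟩
  obtain ⟨s, hs, hsy⟩ := mem_orbit.1 (hf.apply_mem_orbit hK ht hty)
  rw [Submodule.map_sup, Submodule.map_span, Set.image_singleton, sup_le_iff,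
    Submodule.span_singleton_le_iff_mem]
  constructor
  · rintro _ ⟨z, hz, rfl⟩
    obtain ⟨r, hr, hrz⟩ := mem_orbit.1 (hf.ker_le_comap_orbit hK ht ⟨y, hty.symm⟩ hz)
    have hsz : s z ∈ orbit T x :=
      hf.apply_ker_mem_orbit hK hs (hrange ▸ OperatorSpace.apply_mem_orbit hs x) hz
    rw [← hrz]
    exact hmap r hr ((Submodule.add_mem_iff_left _ hsz).1
      (hf.add_mem_orbit_of_chain hK h2 ht hs hr hty hz hsy hrz))
  · rw [← hsy]
    exact hmap s hs (hf.apply_mem_orbit_of_chain hK ht hs hty hsy)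

lemma comap_orbit_eq_top (hrange : LinearMap.range f = orbit T x) {g : T →ₗ[K] U}
    (hg : ∀ t : T, f (g t) = (t : U →ₗ[K] V) x) (hs : s ∈ T) (hsg : ∀ t, s (g t) ∈ orbit T x) :
    (orbit T x).comap s = ⊤ := by
  refine Submodule.eq_top_iff'.2 fun w => ?_
  obtain ⟨t, ht, htw⟩ := mem_orbit.1 (hf.range_le_orbit hK ⟨w, rfl⟩)
  have hker : w - g ⟨t, ht⟩ ∈ LinearMap.ker f := by simp [hg, htw]
  refine (Submodule.sub_mem_iff_left ((orbit T x).comap s) (hsg ⟨t, ht⟩)).1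
    (hf.ker_le_comap_orbit hK hs ?_ hker)
  exact hrange ▸ OperatorSpace.apply_mem_orbit hs x

variable [FiniteDimensional K U]

lemma finrank_comap_orbit (h3 : 3 ≤ finrank K T) (hrange : LinearMap.range f = orbit T x)
    (ht : t ∈ T) (ht0 : t ≠ 0)
    (hrank : 2 * finrank K T - 2 ≤ finrank K (LinearMap.range t)) :
    finrank K T = 3 ∧ finrank K ((orbit T x).comap t) + 1 = finrank K U := by
  obtain ⟨y, hy⟩ : t x ∈ LinearMap.range f := hrange ▸ OperatorSpace.apply_mem_orbit ht x
  have hyker : y ∉ LinearMap.ker f := fun hy0 => ht0 (hf.separating.eq_zero ht (hy ▸ hy0))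
  have hW := finrank_map_add_finrank_inf_ker f ((orbit T x).comap t)
  rw [inf_eq_right.2 (hf.ker_le_comap_orbit hK ht ⟨y, hy⟩)] at hW
  have hU := LinearMap.finrank_range_add_finrank_ker f
  rw [hrange, hf.separating.finrank_orbit] at hU
  have hlower : 2 * finrank K T - 2 + (finrank K (LinearMap.ker f) + 1) ≤
      finrank K U + finrank K (((orbit T x).comap t).map f) := by
    rw [← Submodule.finrank_sup_span_singleton hyker]
    exact (Nat.add_le_add_right hrank _).trans ((finrank_range_add_finrank_le t _).trans
      (Nat.add_le_add_left
        (Submodule.finrank_mono (hf.map_ker_sup_span_le hK (by omega) hrange ht hy.symm)) _))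
  have hupper : 2 * finrank K T - 2 + finrank K ((orbit T x).comap t) ≤
      finrank K U + finrank K T := by
    rw [← hf.separating.finrank_orbit] at hrank ⊢
    exact (Nat.add_le_add_right hrank _).trans ((finrank_range_add_finrank_le t _).trans
      (Nat.add_le_add_left (Submodule.finrank_mono (Submodule.map_comap_le _ _)) _))
  omega

lemma finrank_range_mkQ_comp_le (h3 : 3 ≤ finrank K T) (hrange : LinearMap.range f = orbit T x)
    (ht : t ∈ T) (hrank : t ≠ 0 → 2 * finrank K T - 2 ≤ finrank K (LinearMap.range t)) :
    finrank K (LinearMap.range ((orbit T x).mkQ ∘ₗ t)) ≤ 1 := by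
  by_cases ht0 : t = 0
  · rw [ht0, LinearMap.comp_zero, LinearMap.range_zero, finrank_bot]
    exact zero_le_one
  have hcomap := (hf.finrank_comap_orbit hK h3 hrange ht ht0 (hrank ht0)).2
  have hrn := LinearMap.finrank_range_add_finrank_ker ((orbit T x).mkQ ∘ₗ t)
  rw [LinearMap.ker_comp, Submodule.ker_mkQ] at hrn
  omega

/-- If `f` mapped onto the orbit, there would be a linear map `g` with `s x = f (g s)` for all `s`,
and `(s, t) ↦ s (g t)` would be a nondegenerate alternating map modulo the orbit, on a space of
dimension `3` and with operators of rank at most `1`. -/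
lemma finrank_range_ne (h3 : 3 ≤ finrank K T)
    (hrank : ∀ t ∈ T, t ≠ 0 → 2 * finrank K T - 2 ≤ finrank K (LinearMap.range t)) :
    finrank K (LinearMap.range f) ≠ finrank K T := by
  intro hfT
  have hrange : LinearMap.range f = orbit T x :=
    Submodule.eq_of_le_of_finrank_eq (hf.range_le_orbit hK)
      (by rw [hfT, hf.separating.finrank_orbit])
  obtain ⟨g, hg⟩ := exists_linearMap_apply_eq_apply hrange.ge
  obtain ⟨B, hB⟩ : ∃ B : T →ₗ[K] T →ₗ[K] V ⧸ orbit T x,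
      ∀ s : T, B s = ((orbit T x).mkQ ∘ₗ (s : U →ₗ[K] V)) ∘ₗ g :=
    ⟨(T.subtype.compl₂ g).compr₂ (orbit T x).mkQ, fun _ => rfl⟩
  have hBalt : B.IsAlt := by
    intro s
    rw [hB]
    exact (Submodule.Quotient.mk_eq_zero _).2 (hf.apply_mem_orbit hK s.2 (hg s).symm)
  have hBrank : ∀ s, finrank K (LinearMap.range (B s)) ≤ 1 := by
    intro s
    rw [hB]
    exact (Submodule.finrank_mono (LinearMap.range_comp_le_range _ _)).trans
      (hf.finrank_range_mkQ_comp_le hK h3 hrange s.2 (hrank s s.2))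
  have hcomap : ∀ s : T, s ≠ 0 → finrank K T = 3 ∧
      finrank K ((orbit T x).comap (s : U →ₗ[K] V)) + 1 = finrank K U := fun s hs =>
    have hs' : (s : U →ₗ[K] V) ≠ 0 := fun h => hs (Subtype.ext h)
    hf.finrank_comap_orbit hK h3 hrange s.2 hs' (hrank s s.2 hs')
  have hT : finrank K T = 3 := by
    have : Nontrivial T := nontrivial_of_finrank_pos (R := K) (by omega)
    obtain ⟨s, hs⟩ := exists_ne (0 : T)
    exact (hcomap s hs).1
  obtain ⟨s, hs0, hBs⟩ := exists_ne_zero_map_eq_zero_of_isAlt hT hBalt hBrank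
  have htop := hf.comap_orbit_eq_top hK hrange hg s.2 fun t =>
    (Submodule.Quotient.mk_eq_zero (orbit T x)).1 (by
      rw [hB] at hBs
      exact LinearMap.congr_fun hBs t)
  have hcodim := (hcomap s hs0).2
  rw [htop, finrank_top] at hcodim
  omega

end Ranks

section CorankOne

variable [FiniteDimensional K T] (hf : IsAnnihilator T x f)
  (hK : (finrank K T : Cardinal.{u}) < Cardinal.mk K)
  (hcorank : finrank K (LinearMap.range f) + 1 = finrank K T) {y z : U} {s t : U →ₗ[K] V}

include hf hK hcorank

lemma range_sup_span_eq_orbit {v : V} (hv : v ∈ orbit T x) (hvf : v ∉ LinearMap.range f) :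
    LinearMap.range f ⊔ (K ∙ v) = orbit T x := by
  have hle : LinearMap.range f ⊔ (K ∙ v) ≤ orbit T x :=
    sup_le (hf.range_le_orbit hK) ((Submodule.span_singleton_le_iff_mem _ _).2 hv)
  have := Submodule.finiteDimensional_of_le hle
  have hlt := Submodule.finrank_lt_finrank_of_lt (Submodule.lt_sup_iff_notMem.2 hvf)
  refine Submodule.eq_of_le_of_finrank_le hle ?_
  rwa [hf.separating.finrank_orbit, ← hcorank, Nat.succ_le_iff]

lemma orbit_le_orbit_of_apply_notMem_range (h2 : 2 ≤ finrank K T) (hz : f z = 0) (hs : s ∈ T)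
    (hsx : s x ∈ LinearMap.range f) (hsz : s z ∉ LinearMap.range f) : orbit T z ≤ orbit T x := by
  have hszO : s z ∈ orbit T x := hf.apply_ker_mem_orbit hK hs hsx hz
  obtain ⟨w, hw⟩ := hsx
  obtain ⟨q, hq, hqx⟩ := mem_orbit.1 hszO
  obtain ⟨p, hp, hpx⟩ := mem_orbit.1 (hf.apply_mem_orbit hK hs hw.symm)
  have hqz := hf.apply_ker_mem_orbit_of_chain hK h2 hs hp hq hw.symm hz hpx hqx
  refine orbit_le_iff.2 fun r hr => ?_
  have hrx := OperatorSpace.apply_mem_orbit hr x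
  rw [← hf.range_sup_span_eq_orbit hK hcorank hszO hsz, Submodule.mem_sup] at hrx
  obtain ⟨v, hv, _, hd, hvd⟩ := hrx
  obtain ⟨d, rfl⟩ := Submodule.mem_span_singleton.1 hd
  have hrq : (r - d • q) z ∈ orbit T x :=
    hf.apply_ker_mem_orbit hK (T.sub_mem hr (T.smul_mem d hq))
      (by simpa [hqx, ← hvd] using hv) hz
  exact (Submodule.sub_mem_iff_left _ (Submodule.smul_mem _ d hqz)).1 hrq

lemma orbit_ker_le_orbit (h2 : 2 ≤ finrank K T) (hz : f z = 0) (hs : s ∈ T)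
    (hsx : s x ∈ LinearMap.range f) (hsz : s z ∉ LinearMap.range f) {w : U} (hw : f w = 0) :
    orbit T w ≤ orbit T x := by
  by_cases hsw : s w ∈ LinearMap.range f
  · have hszO := hf.orbit_le_orbit_of_apply_notMem_range hK hcorank h2 hz hs hsx hsz
    have hswzO := hf.orbit_le_orbit_of_apply_notMem_range hK hcorank h2 (z := w + z)
      (by simp [hw, hz]) hs hsx (by rwa [map_add, Submodule.add_mem_iff_right _ hsw])
    rw [orbit_le_iff] at hszO hswzO ⊢
    intro r hr
    have hrwz := hswzO r hr
    rwa [map_add, Submodule.add_mem_iff_left _ (hszO r hr)] at hrwz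
  · exact hf.orbit_le_orbit_of_apply_notMem_range hK hcorank h2 hw hs hsx hsw

variable [FiniteDimensional K U]

lemma ker_sup_span_eq_comap_orbit (ht : t ∈ T) (ht0 : t ≠ 0)
    (hrank : 2 * finrank K T - 2 ≤ finrank K (LinearMap.range t)) (hty : t x = f y) :
    LinearMap.ker f ⊔ (K ∙ y) = (orbit T x).comap t := by
  have hyker : y ∉ LinearMap.ker f := fun hy0 => ht0 (hf.separating.eq_zero ht (hty.trans hy0))
  refine Submodule.eq_of_le_of_finrank_le (hf.ker_sup_span_le_comap_orbit hK ht hty) ?_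
  have hU := LinearMap.finrank_range_add_finrank_ker f
  have hcomap := finrank_range_add_finrank_le t ((orbit T x).comap t)
  have hmap : finrank K (((orbit T x).comap t).map t) ≤ finrank K T :=
    hf.separating.finrank_orbit ▸ Submodule.finrank_mono (Submodule.map_comap_le _ _)
  rw [Submodule.finrank_sup_span_singleton hyker]
  omega

lemma map_ker_sup_span_eq_orbit (ht : t ∈ T) (ht0 : t ≠ 0)
    (hrank : 2 * finrank K T - 2 ≤ finrank K (LinearMap.range t)) (hty : t x = f y) :
    (LinearMap.ker f).map t ⊔ (K ∙ t y) = orbit T x := by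
  have hyker : y ∉ LinearMap.ker f := fun hy0 => ht0 (hf.separating.eq_zero ht (hty.trans hy0))
  rw [← Set.image_singleton, ← Submodule.map_span, ← Submodule.map_sup]
  refine Submodule.eq_of_le_of_finrank_le
    (Submodule.map_le_iff_le_comap.2 (hf.ker_sup_span_le_comap_orbit hK ht hty)) ?_
  have hU := LinearMap.finrank_range_add_finrank_ker f
  have hmap := finrank_range_add_finrank_le t (LinearMap.ker f ⊔ (K ∙ y))
  rw [Submodule.finrank_sup_span_singleton hyker] at hmap
  rw [hf.separating.finrank_orbit]
  omega

lemma orbit_le_orbit_of_ker (h2 : 2 ≤ finrank K T) (ht : t ∈ T) (ht0 : t ≠ 0)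
    (hrank : 2 * finrank K T - 2 ≤ finrank K (LinearMap.range t)) (hty : t x = f y)
    (hker : ∀ z, f z = 0 → orbit T z ≤ orbit T x) : orbit T y ≤ orbit T x := by
  obtain ⟨p, hp, hpx⟩ := mem_orbit.1 (hf.apply_mem_orbit hK ht hty)
  refine orbit_le_iff.2 fun s hs => ?_
  have hsx := OperatorSpace.apply_mem_orbit hs x
  rw [← hf.map_ker_sup_span_eq_orbit hK hcorank ht ht0 hrank hty, Submodule.mem_sup] at hsx
  obtain ⟨_, ⟨z, hz, rfl⟩, _, hd, hzd⟩ := hsx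
  obtain ⟨d, rfl⟩ := Submodule.mem_span_singleton.1 hd
  have hsum := hf.add_mem_orbit_of_chain hK h2 ht hp (T.sub_mem hs (T.smul_mem d hp)) hty hz hpx
    (by simp [← hzd, hpx])
  have hdiff := (Submodule.add_mem_iff_left _ (orbit_le_iff.1 (hker z hz) p hp)).1 hsum
  have hpy := hf.apply_mem_orbit_of_chain hK ht hp hty hpx
  exact (Submodule.sub_mem_iff_left _ (Submodule.smul_mem _ d hpy)).1 hdiff

lemma not_orbit_le_orbit (h3 : 3 ≤ finrank K T) (ht : t ∈ T) (ht0 : t ≠ 0)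
    (hrank : 2 * finrank K T - 2 ≤ finrank K (LinearMap.range t)) (hty : t x = f y) :
    ¬ orbit T y ≤ orbit T x := by
  intro hy
  have hrange : LinearMap.range f ≤ K ∙ f y := by
    rintro _ ⟨w, rfl⟩
    obtain ⟨s, hs, hsx⟩ := mem_orbit.1 (hf.range_le_orbit hK ⟨w, rfl⟩)
    have hw : w ∈ (orbit T x).comap t :=
      (hf.apply_mem_orbit_iff hK ht hs hty hsx).2 (orbit_le_iff.1 hy s hs)
    rw [← hf.ker_sup_span_eq_comap_orbit hK hcorank ht ht0 hrank hty] at hw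
    have hfw := Submodule.mem_map_of_mem (f := f) hw
    rwa [Submodule.map_sup, LinearMap.le_ker_iff_map.1 (le_refl (LinearMap.ker f)), bot_sup_eq,
      Submodule.map_span, Set.image_singleton] at hfw
  have hle := (Submodule.finrank_mono hrange).trans (finrank_span_le_card {f y})
  rw [Set.toFinset_singleton, Finset.card_singleton] at hle
  omega

lemma map_ker_eq_range (h3 : 3 ≤ finrank K T) (ht : t ∈ T) (ht0 : t ≠ 0)
    (hrank : 2 * finrank K T - 2 ≤ finrank K (LinearMap.range t))
    (htx : t x ∈ LinearMap.range f) : (LinearMap.ker f).map t = LinearMap.range f := by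
  obtain ⟨y, hy⟩ := htx
  have hle : (LinearMap.ker f).map t ≤ LinearMap.range f := by
    rintro _ ⟨z, hz, rfl⟩
    by_contra htz
    have hker : ∀ w, f w = 0 → orbit T w ≤ orbit T x := fun w hw =>
      hf.orbit_ker_le_orbit hK hcorank (by omega) hz ht ⟨y, hy⟩ htz hw
    exact hf.not_orbit_le_orbit hK hcorank h3 ht ht0 hrank hy.symm
      (hf.orbit_le_orbit_of_ker hK hcorank (by omega) ht ht0 hrank hy.symm hker)
  refine Submodule.eq_of_le_of_finrank_le hle ?_
  have hsup := Submodule.finrank_add_le_finrank_add_finrank ((LinearMap.ker f).map t) (K ∙ t y)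
  rw [hf.map_ker_sup_span_eq_orbit hK hcorank ht ht0 hrank hy.symm,
    hf.separating.finrank_orbit] at hsup
  have hspan : finrank K (K ∙ t y) ≤ 1 := by simpa using finrank_span_le_card (R := K) {t y}
  omega

end CorankOne

end IsAnnihilator

end Annihilator

section AnnihilatorPair

variable {K : Type u} [Field K] {U : Type v} [AddCommGroup U] [Module K U]
  {V : Type w} [AddCommGroup V] [Module K V] {T : Submodule K (U →ₗ[K] V)} {x y z : U}
  {f h q s : U →ₗ[K] V}

/-- Two distinct operators `f` and `h` of one coset of `T` other than `T` itself which are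
annihilators of `x` and of `y` respectively. -/
structure IsAnnihilatorPair (T : Submodule K (U →ₗ[K] V)) (x y : U) (f h : U →ₗ[K] V) : Prop where
  left : IsAnnihilator T x f
  right : IsAnnihilator T y h
  diff_mem : f - h ∈ T
  ne : f ≠ h
  notMem : f ∉ T

lemma IsSeparatingVector.exists_isAnnihilator (hx : IsSeparatingVector T x) {g : U →ₗ[K] V}
    (hg : g ∈ reflexiveClosure T) : ∃ f, IsAnnihilator T x f ∧ g - f ∈ T := by
  obtain ⟨t, ht, htx⟩ := hg x
  exact ⟨g - t, ⟨hx, sub_mem hg (le_reflexiveClosure T ht), by simp [htx]⟩, by simpa⟩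

lemma exists_isAnnihilatorPair [FiniteDimensional K T]
    (hK : (finrank K T : Cardinal.{u}) < Cardinal.mk K) (hsep : ∃ x, IsSeparatingVector T x)
    (hT : ¬ IsReflexive T) : ∃ x y f h, IsAnnihilatorPair T x y f h := by
  obtain ⟨g, hg, hgT⟩ := SetLike.exists_of_lt ((le_reflexiveClosure T).lt_of_ne hT)
  obtain ⟨x, hx⟩ := hsep
  obtain ⟨f, hf, hgf⟩ := hx.exists_isAnnihilator hg
  have hfT : f ∉ T := fun h => hgT ((Submodule.sub_mem_iff_left T h).1 hgf)
  by_contra! hpair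
  have hfsep : ∀ y, IsSeparatingVector T y → f y = 0 := by
    intro y hy
    obtain ⟨h, hh, hfh⟩ := hy.exists_isAnnihilator hf.mem_reflexiveClosure
    have hfh_eq : f = h := by
      by_contra hne
      exact hpair x y f h ⟨hf, hh, hfh, hne, hfT⟩
    rw [hfh_eq, hh.apply_eq_zero]
  have hf0 : f = 0 := by
    ext w
    by_cases hw : IsSeparatingVector T w
    · exact hfsep w hw
    · obtain ⟨c, hc, hxw⟩ := hx.exists_add_smul hK hw
      simpa [hf.apply_eq_zero, hc] using hfsep _ hxw
  exact hfT (hf0 ▸ T.zero_mem)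

/-- The operators of the space spanned by `T` and `f` that map `x` into the range of `f` and `y`
into the range of `h`. In coordinates adapted to an annihilator pair they are the operators
`(b, c) ↦ (a ⋆ c, a • b)`, those with no diagonal part. -/
def offDiagonal (T : Submodule K (U →ₗ[K] V)) (x y : U) (f h : U →ₗ[K] V) :
    Submodule K (U →ₗ[K] V) :=
  (T ⊔ (K ∙ f)) ⊓ (LinearMap.range f).comap (LinearMap.applyₗ x) ⊓
    (LinearMap.range h).comap (LinearMap.applyₗ y)

lemma mem_offDiagonal : q ∈ offDiagonal T x y f h ↔
    q ∈ T ⊔ (K ∙ f) ∧ q x ∈ LinearMap.range f ∧ q y ∈ LinearMap.range h := by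
  simp [offDiagonal, and_assoc]

namespace IsAnnihilatorPair

section General

variable (hp : IsAnnihilatorPair T x y f h)

include hp

lemma symm : IsAnnihilatorPair T y x h f where
  left := hp.right
  right := hp.left
  diff_mem := neg_sub f h ▸ neg_mem hp.diff_mem
  ne := hp.ne.symm
  notMem hh := hp.notMem ((Submodule.sub_mem_iff_left T hh).1 hp.diff_mem)

lemma sup_span_eq : T ⊔ (K ∙ f) = T ⊔ (K ∙ h) := by
  suffices hle : ∀ {x y f h}, IsAnnihilatorPair T x y f h → T ⊔ (K ∙ f) ≤ T ⊔ (K ∙ h) from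
    le_antisymm (hle hp) (hle hp.symm)
  intro x y f h hp
  refine sup_le le_sup_left ((Submodule.span_singleton_le_iff_mem _ _).2 ?_)
  rw [← sub_add_cancel f h]
  exact add_mem (Submodule.mem_sup_left hp.diff_mem)
    (Submodule.mem_sup_right (Submodule.mem_span_singleton_self h))

lemma offDiagonal_comm : offDiagonal T x y f h = offDiagonal T y x h f := by
  ext q
  rw [mem_offDiagonal, mem_offDiagonal, hp.sup_span_eq]
  tauto

lemma apply_right_ne_zero : f y ≠ 0 := fun hfy =>
  hp.ne (sub_eq_zero.1 (hp.right.separating.eq_zero hp.diff_mem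
    (by simp [hfy, hp.right.apply_eq_zero])))

end General

section Ranks

variable [FiniteDimensional K U] [FiniteDimensional K T] (hp : IsAnnihilatorPair T x y f h)
  (hK : (finrank K T : Cardinal.{u}) < Cardinal.mk K) (h3 : 3 ≤ finrank K T)
  (hrank : ∀ t ∈ T, t ≠ 0 → 2 * finrank K T - 2 ≤ finrank K (LinearMap.range t))

include hp hK h3 hrank

lemma finrank_range_lt : finrank K (LinearMap.range f) < finrank K T :=
  lt_of_le_of_ne
    (hp.left.separating.finrank_orbit ▸ Submodule.finrank_mono (hp.left.range_le_orbit hK))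
    (hp.left.finrank_range_ne hK h3 hrank)

lemma finrank_range_add_one : finrank K (LinearMap.range f) + 1 = finrank K T := by
  have hf := hp.finrank_range_lt hK h3 hrank
  have hh := hp.symm.finrank_range_lt hK h3 hrank
  have hsup := (hrank _ hp.diff_mem (sub_ne_zero.2 hp.ne)).trans (finrank_range_sub_le f h)
  have hadd := Submodule.finrank_add_le_finrank_add_finrank (LinearMap.range f) (LinearMap.range h)
  omega

lemma disjoint_range : Disjoint (LinearMap.range f) (LinearMap.range h) := by
  have hf := hp.finrank_range_add_one hK h3 hrank
  have hh := hp.symm.finrank_range_add_one hK h3 hrank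
  have hsup := (hrank _ hp.diff_mem (sub_ne_zero.2 hp.ne)).trans (finrank_range_sub_le f h)
  have hadd := Submodule.finrank_sup_add_finrank_inf_eq (LinearMap.range f) (LinearMap.range h)
  exact disjoint_iff.2 (Submodule.finrank_eq_zero.1 (by omega))

lemma apply_right_notMem_range : f y ∉ LinearMap.range h := fun hfy =>
  hp.apply_right_ne_zero (Submodule.disjoint_def.1 (hp.disjoint_range hK h3 hrank) _ ⟨y, rfl⟩ hfy)

lemma exists_sub_smul_apply_mem_range (hs : s ∈ T ⊔ (K ∙ f)) :
    ∃ c : K, (s - c • f) y ∈ LinearMap.range h := by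
  have hle : T ⊔ (K ∙ f) ≤ reflexiveClosure T := sup_le (le_reflexiveClosure T)
    ((Submodule.span_singleton_le_iff_mem _ _).2 hp.left.mem_reflexiveClosure)
  have horbit := orbit_eq_of_le_reflexiveClosure le_sup_left hle y
  have hfy : f y ∈ orbit T y :=
    horbit ▸ apply_mem_orbit (Submodule.mem_sup_right (Submodule.mem_span_singleton_self f)) y
  have hsy : s y ∈ LinearMap.range h ⊔ (K ∙ f y) := by
    rw [hp.right.range_sup_span_eq_orbit hK (hp.symm.finrank_range_add_one hK h3 hrank) hfy
      (hp.apply_right_notMem_range hK h3 hrank), ← horbit]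
    exact apply_mem_orbit hs y
  obtain ⟨v, hv, _, hc, hvc⟩ := Submodule.mem_sup.1 hsy
  obtain ⟨c, rfl⟩ := Submodule.mem_span_singleton.1 hc
  exact ⟨c, by simpa [← hvc] using hv⟩

lemma offDiagonal_sup_span : offDiagonal T x y f h ⊔ Submodule.span K {f, h} = T ⊔ (K ∙ f) := by
  have hfS : f ∈ T ⊔ (K ∙ f) := Submodule.mem_sup_right (Submodule.mem_span_singleton_self f)
  have hhS : h ∈ T ⊔ (K ∙ f) :=
    hp.sup_span_eq ▸ Submodule.mem_sup_right (Submodule.mem_span_singleton_self h)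
  refine le_antisymm (sup_le (fun q hq => (mem_offDiagonal.1 hq).1)
    (Submodule.span_le.2 (Set.pair_subset hfS hhS))) fun s hs => ?_
  obtain ⟨c, hc⟩ := hp.exists_sub_smul_apply_mem_range hK h3 hrank hs
  obtain ⟨d, hd⟩ := hp.symm.exists_sub_smul_apply_mem_range hK h3 hrank (hp.sup_span_eq ▸ hs)
  have hq : s - c • f - d • h ∈ offDiagonal T x y f h := by
    refine mem_offDiagonal.2
      ⟨sub_mem (sub_mem hs (Submodule.smul_mem _ c hfS)) (Submodule.smul_mem _ d hhS), ?_, ?_⟩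
    · simpa [hp.left.apply_eq_zero] using hd
    · simpa [hp.right.apply_eq_zero] using hc
  refine Submodule.mem_sup.2 ⟨_, hq, c • f + d • h, Submodule.mem_span_pair.2 ⟨c, d, rfl⟩, ?_⟩
  module

lemma smul_add_smul_mem_offDiagonal {c d : K} (hcd : c • f + d • h ∈ offDiagonal T x y f h) :
    c = 0 ∧ d = 0 := by
  obtain ⟨-, hx, hy⟩ := mem_offDiagonal.1 hcd
  simp only [LinearMap.add_apply, LinearMap.smul_apply, hp.left.apply_eq_zero, smul_zero,
    zero_add] at hx
  simp only [LinearMap.add_apply, LinearMap.smul_apply, hp.right.apply_eq_zero, smul_zero,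
    add_zero] at hy
  constructor <;> by_contra hne
  · exact hp.apply_right_notMem_range hK h3 hrank ((Submodule.smul_mem_iff _ hne).1 hy)
  · exact hp.symm.apply_right_notMem_range hK h3 hrank ((Submodule.smul_mem_iff _ hne).1 hx)

lemma disjoint_offDiagonal_span : Disjoint (offDiagonal T x y f h) (Submodule.span K {f, h}) := by
  refine Submodule.disjoint_def.2 fun q hq hqs => ?_
  obtain ⟨c, d, rfl⟩ := Submodule.mem_span_pair.1 hqs
  obtain ⟨rfl, rfl⟩ := hp.smul_add_smul_mem_offDiagonal hK h3 hrank hq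
  rw [zero_smul, zero_smul, add_zero]

lemma finrank_offDiagonal : finrank K (offDiagonal T x y f h) + 1 = finrank K T := by
  have hf0 : f ≠ 0 := fun hf => hp.notMem (hf ▸ T.zero_mem)
  have hli : LinearIndependent K ![f, h] := LinearIndependent.pair_iff.2 fun c d hcd =>
    hp.smul_add_smul_mem_offDiagonal hK h3 hrank (hcd ▸ zero_mem _)
  have hpair : finrank K (Submodule.span K {f, h}) = 2 := by
    rw [← Matrix.range_cons_cons_empty f h ![], finrank_span_eq_card hli, Fintype.card_fin]
  have hsup := hp.offDiagonal_sup_span hK h3 hrank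
  have : FiniteDimensional K (offDiagonal T x y f h) :=
    Submodule.finiteDimensional_of_le (hsup ▸ le_sup_left)
  have : FiniteDimensional K (Submodule.span K {f, h}) :=
    Submodule.finiteDimensional_of_le (hsup ▸ le_sup_right)
  have hQ := Submodule.finrank_sup_add_finrank_inf_eq (offDiagonal T x y f h)
    (Submodule.span K {f, h})
  have hT := Submodule.finrank_sup_add_finrank_inf_eq T (K ∙ f)
  rw [hsup, (hp.disjoint_offDiagonal_span hK h3 hrank).eq_bot, finrank_bot, hpair] at hQ
  rw [((Submodule.disjoint_span_singleton' hf0).2 hp.notMem).eq_bot, finrank_bot,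
    finrank_span_singleton hf0] at hT
  omega

lemma map_ker_eq_range (hq : q ∈ offDiagonal T x y f h) (hq0 : q ≠ 0) :
    (LinearMap.ker f).map q = LinearMap.range f := by
  obtain ⟨hqS, hqx, -⟩ := mem_offDiagonal.1 hq
  obtain ⟨t, ht, _, hc, rfl⟩ := Submodule.mem_sup.1 hqS
  obtain ⟨c, rfl⟩ := Submodule.mem_span_singleton.1 hc
  have ht0 : t ≠ 0 := by
    rintro rfl
    have hc0 : c = 0 :=
      (hp.smul_add_smul_mem_offDiagonal hK h3 hrank (c := c) (d := 0) (by simpa using hq)).1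
    simp [hc0] at hq0
  rw [← hp.left.map_ker_eq_range hK (hp.finrank_range_add_one hK h3 hrank) h3 ht ht0
    (hrank t ht ht0) (by simpa [hp.left.apply_eq_zero] using hqx)]
  exact SetLike.coe_injective (Set.image_congr fun z hz => by simp [LinearMap.mem_ker.1 hz])

lemma exists_mem_offDiagonal_add (hs : s ∈ T ⊔ (K ∙ f)) :
    ∃ q ∈ offDiagonal T x y f h, ∃ c d : K, s = q + (c • f + d • h) := by
  rw [← hp.offDiagonal_sup_span hK h3 hrank] at hs
  obtain ⟨q, hq, _, hcd, rfl⟩ := Submodule.mem_sup.1 hs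
  obtain ⟨c, d, rfl⟩ := Submodule.mem_span_pair.1 hcd
  exact ⟨q, hq, c, d, rfl⟩

lemma apply_ker_mem_range (hq : q ∈ offDiagonal T x y f h) (hz : f z = 0) :
    q z ∈ LinearMap.range f := by
  by_cases hq0 : q = 0
  · rw [hq0, LinearMap.zero_apply]
    exact zero_mem _
  · rw [← hp.map_ker_eq_range hK h3 hrank hq hq0]
    exact Submodule.mem_map_of_mem hz

lemma apply_ker_mem_range_right (hq : q ∈ offDiagonal T x y f h) (hz : h z = 0) :
    q z ∈ LinearMap.range h :=
  hp.symm.apply_ker_mem_range hK h3 hrank (hp.offDiagonal_comm ▸ hq) hz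

lemma disjoint_ker (hT : kernel T = ⊥) : Disjoint (LinearMap.ker f) (LinearMap.ker h) := by
  refine Submodule.disjoint_def.2 fun z hfz hhz => ?_
  have hTz : z ∈ kernel T := by
    simp only [kernel, Submodule.mem_iInf, LinearMap.mem_ker]
    intro t ht
    obtain ⟨q, hq, c, d, rfl⟩ :=
      hp.exists_mem_offDiagonal_add hK h3 hrank (Submodule.mem_sup_left ht)
    have hqz : q z = 0 := Submodule.disjoint_def.1 (hp.disjoint_range hK h3 hrank) _
      (hp.apply_ker_mem_range hK h3 hrank hq hfz) (hp.apply_ker_mem_range_right hK h3 hrank hq hhz)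
    simp [hqz, LinearMap.mem_ker.1 hfz, LinearMap.mem_ker.1 hhz]
  rwa [hT, Submodule.mem_bot] at hTz

lemma finrank_ker_add_one (hT : kernel T = ⊥) : finrank K (LinearMap.ker f) + 1 = finrank K T := by
  have hf := hp.finrank_range_add_one hK h3 hrank
  have hh := hp.symm.finrank_range_add_one hK h3 hrank
  have hfU := LinearMap.finrank_range_add_finrank_ker f
  have hhU := LinearMap.finrank_range_add_finrank_ker h
  have hU := (hrank _ hp.diff_mem (sub_ne_zero.2 hp.ne)).trans (LinearMap.finrank_range_le _)
  have hadd := Submodule.finrank_add_finrank_le_of_disjoint (hp.disjoint_ker hK h3 hrank hT)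
  omega

lemma isCompl_ker (hT : kernel T = ⊥) : IsCompl (LinearMap.ker f) (LinearMap.ker h) := by
  have hf := hp.finrank_range_add_one hK h3 hrank
  have hfker := hp.finrank_ker_add_one hK h3 hrank hT
  have hhker := hp.symm.finrank_ker_add_one hK h3 hrank hT
  have hU := LinearMap.finrank_range_add_finrank_ker f
  exact (Submodule.isCompl_iff_disjoint _ _ (by omega)).2 (hp.disjoint_ker hK h3 hrank hT)

lemma isCompl_range (hT : IsReduced T) : IsCompl (LinearMap.range f) (LinearMap.range h) := by
  refine ⟨hp.disjoint_range hK h3 hrank, codisjoint_iff_le_sup.2 ?_⟩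
  rw [← hT.2]
  refine iSup₂_le fun t ht => ?_
  rintro _ ⟨w, rfl⟩
  obtain ⟨q, hq, c, d, rfl⟩ :=
    hp.exists_mem_offDiagonal_add hK h3 hrank (Submodule.mem_sup_left ht)
  have hw : w ∈ LinearMap.ker f ⊔ LinearMap.ker h :=
    (hp.isCompl_ker hK h3 hrank hT.1).sup_eq_top ▸ Submodule.mem_top
  obtain ⟨z, hz, z', hz', rfl⟩ := Submodule.mem_sup.1 hw
  have hqz := hp.apply_ker_mem_range hK h3 hrank hq hz
  have hqz' := hp.apply_ker_mem_range_right hK h3 hrank hq hz'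
  have hsplit : (q + (c • f + d • h)) (z + z') = (q z + f (c • z')) + (q z' + h (d • z)) := by
    simp only [LinearMap.add_apply, LinearMap.smul_apply, map_add, map_smul,
      LinearMap.mem_ker.1 hz, LinearMap.mem_ker.1 hz']
    module
  rw [hsplit]
  exact Submodule.add_mem_sup (add_mem hqz ⟨_, rfl⟩) (add_mem hqz' ⟨_, rfl⟩)

end Ranks

end IsAnnihilatorPair

end AnnihilatorPair

section Equivalence

variable {K : Type u} [Field K]
  {U : Type v} [AddCommGroup U] [Module K U] {V : Type w} [AddCommGroup V] [Module K V]
  {U' : Type v'} [AddCommGroup U'] [Module K U'] {V' : Type w'} [AddCommGroup V'] [Module K V']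
  {S T : Submodule K (U →ₗ[K] V)} {S' : Submodule K (U' →ₗ[K] V')}

lemma equivalent_iff : Equivalent S S' ↔
    ∃ (F : U' ≃ₗ[K] U) (G : V' ≃ₗ[K] V), S = S'.map (LinearEquiv.arrowCongr F G).toLinearMap := by
  refine ⟨fun ⟨F, G, h⟩ => ⟨F.symm, G, ?_⟩, fun ⟨F, G, h⟩ => ⟨F.symm, G, ?_⟩⟩
  · ext f
    simp only [h, Submodule.mem_map, eq_comm (a := f)]
    rfl
  · intro f
    simp only [h, Submodule.mem_map, eq_comm (a := f)]
    rfl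

lemma IsHyperplaneOf.of_map (e : (U' →ₗ[K] V') ≃ₗ[K] (U →ₗ[K] V))
    (hT : IsHyperplaneOf T (S'.map e.toLinearMap)) :
    IsHyperplaneOf (T.comap e.toLinearMap) S' := by
  refine ⟨(Submodule.comap_mono hT.1).trans
    (Submodule.comap_map_eq_of_injective e.injective S').le, ?_⟩
  rw [← hT.2]
  exact (Submodule.Quotient.equiv _ _ (e.submoduleMap S')
    (Submodule.map_comap_eq_of_surjective (e.submoduleMap S').surjective
      (T.submoduleOf (S'.map e.toLinearMap)))).finrank_eq

lemma Equivalent.exists_isHyperplaneOf (hS : Equivalent S S') (hT : IsHyperplaneOf T S) :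
    ∃ H, IsHyperplaneOf H S' ∧ Equivalent T H := by
  obtain ⟨F, G, rfl⟩ := equivalent_iff.1 hS
  exact ⟨_, hT.of_map _, equivalent_iff.2 ⟨F, G, (Submodule.map_comap_eq_of_surjective
    (LinearEquiv.arrowCongr F G).surjective T).symm⟩⟩

lemma Equivalent.exists_isSeparatingVector (hS : Equivalent S S') {p : U'}
    (hp : IsSeparatingVector S' p) : ∃ x, IsSeparatingVector S x := by
  obtain ⟨F, G, h⟩ := hS
  refine ⟨F.symm p, isSeparatingVector_iff.2 fun t ht htp => ?_⟩
  obtain ⟨g, hg, rfl⟩ := (h t).1 ht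
  have hg0 : g = 0 := hp.eq_zero hg (by simpa using htp)
  rw [hg0, LinearMap.zero_comp, LinearMap.comp_zero]

lemma isHyperplaneOf_sup_span_singleton {f : U →ₗ[K] V} (hf : f ∉ T) :
    IsHyperplaneOf T (T ⊔ (K ∙ f)) := by
  have hfS : f ∈ T ⊔ (K ∙ f) := Submodule.mem_sup_right (Submodule.mem_span_singleton_self f)
  refine ⟨le_sup_left, finrank_eq_one (Submodule.Quotient.mk ⟨f, hfS⟩) ?_ ?_⟩
  · rwa [Ne, Submodule.Quotient.mk_eq_zero]
  · rintro ⟨s, hs⟩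
    obtain ⟨t, ht, _, hc, rfl⟩ := Submodule.mem_sup.1 hs
    obtain ⟨c, rfl⟩ := Submodule.mem_span_singleton.1 hc
    refine ⟨c, ((Submodule.Quotient.eq _).2 ?_).symm⟩
    simpa [Submodule.submoduleOf] using ht

lemma not_isSeparatingVector_sup_span_singleton {f : U →ₗ[K] V} (hf : f ∈ reflexiveClosure T)
    (hfT : f ∉ T) (x : U) : ¬ IsSeparatingVector (T ⊔ (K ∙ f)) x := by
  intro hx
  obtain ⟨t, ht, htx⟩ := hf x
  have hft : t = f := hx.eq (Submodule.mem_sup_left ht)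
    (Submodule.mem_sup_right (Submodule.mem_span_singleton_self f)) htx
  exact hfT (hft ▸ ht)

end Equivalence

section Twisted

variable {K : Type u} [Field K] {A : Type v} [AddCommGroup A] [Module K A]

lemma isQuasiLeftInversion_of_forall_not_isSeparatingVector {star bullet : A →ₗ[K] A →ₗ[K] A}
    (hbullet : IsRegular bullet)
    (hsep : ∀ p, ¬ IsSeparatingVector (twistedOperatorSpace star bullet) p) :
    IsQuasiLeftInversion star fun x y => bullet x y := by
  have hzero : ∀ x y, bullet x y = 0 ↔ x = 0 ∨ y = 0 := by
    refine fun x y => ⟨fun hxy => ?_, by rintro (rfl | rfl) <;> simp⟩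
    by_contra! hne
    exact hbullet x y hne.1 hne.2 hxy
  refine ⟨hzero, fun a y hind => ?_⟩
  have hy : y ≠ 0 := by simpa using hind.ne_zero 1
  obtain ⟨_, ⟨⟨a', b, c⟩, rfl⟩, h0, hne⟩ :
      ∃ t ∈ twistedOperatorSpace star bullet, t (y, bullet a y) = 0 ∧ t ≠ 0 := by
    by_contra! h
    exact hsep _ (isSeparatingVector_iff.2 h)
  have hstar : star a' (bullet a y) + b • y = 0 := congrArg Prod.fst h0
  have hbul : bullet (a' + c • a) y = 0 := by simpa [twistedMap] using congrArg Prod.snd h0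
  have ha' : a' = -c • a := by
    rw [neg_smul]
    exact eq_neg_of_add_eq_zero_left (((hzero _ _).1 hbul).resolve_right hy)
  rw [ha', map_smul, LinearMap.smul_apply] at hstar
  obtain ⟨hc, rfl⟩ := LinearIndependent.pair_iff.1 hind _ _ hstar
  rw [neg_eq_zero] at hc
  exact hne (by rw [ha', hc, neg_zero, zero_smul, ← Prod.zero_eq_mk, ← Prod.zero_eq_mk, map_zero])

lemma Equivalent.isQuasiLeftInversion {U : Type v'} [AddCommGroup U] [Module K U] {V : Type w}
    [AddCommGroup V] [Module K V] {T : Submodule K (U →ₗ[K] V)} {f : U →ₗ[K] V}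
    {star bullet : A →ₗ[K] A →ₗ[K] A}
    (hT : Equivalent (T ⊔ (K ∙ f)) (twistedOperatorSpace star bullet))
    (hf : f ∈ reflexiveClosure T) (hfT : f ∉ T) (hbullet : IsRegular bullet) :
    IsQuasiLeftInversion star fun x y => bullet x y :=
  isQuasiLeftInversion_of_forall_not_isSeparatingVector hbullet fun _ hp =>
    let ⟨x, hx⟩ := hT.exists_isSeparatingVector hp
    not_isSeparatingVector_sup_span_singleton hf hfT x hx

lemma isRegular_of_surjective [FiniteDimensional K A] {star : A →ₗ[K] A →ₗ[K] A}
    (hstar : ∀ a, a ≠ 0 → Function.Surjective (star a)) : IsRegular star :=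
  fun a b ha hb hab => hb ((injective_iff_map_eq_zero (star a)).1
    (LinearMap.injective_iff_surjective.2 (hstar a ha)) b hab)

/-- The upper right blocks of the endomorphisms `ψ a` of `A × A`. -/
def upperRightBlock (ψ : A →ₗ[K] (A × A) →ₗ[K] (A × A)) : A →ₗ[K] A →ₗ[K] A :=
  (ψ.compl₂ (LinearMap.inr K A A)).compr₂ (LinearMap.fst K A A)

/-- The lower left blocks of the endomorphisms `ψ a` of `A × A`. -/
def lowerLeftBlock (ψ : A →ₗ[K] (A × A) →ₗ[K] (A × A)) : A →ₗ[K] A →ₗ[K] A :=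
  (ψ.compl₂ (LinearMap.inl K A A)).compr₂ (LinearMap.snd K A A)

lemma twistedOperatorSpace_blocks {ψ : A →ₗ[K] (A × A) →ₗ[K] (A × A)}
    (hlower : ∀ a z, (ψ a (0, z)).2 = 0) (hupper : ∀ a y, (ψ a (y, 0)).1 = 0) :
    twistedOperatorSpace (upperRightBlock ψ) (lowerLeftBlock ψ) =
      LinearMap.range ψ ⊔ Submodule.span K {LinearMap.inl K A A ∘ₗ LinearMap.fst K A A,
        LinearMap.inr K A A ∘ₗ LinearMap.snd K A A} := by
  have hmap : ∀ a c d, twistedMap (upperRightBlock ψ) (lowerLeftBlock ψ) (a, c, d) =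
      ψ a + (c • LinearMap.inl K A A ∘ₗ LinearMap.fst K A A +
        d • LinearMap.inr K A A ∘ₗ LinearMap.snd K A A) := by
    intro a c d
    ext z <;> simp [twistedMap, upperRightBlock, lowerLeftBlock, hlower, hupper]
  ext g
  simp only [twistedOperatorSpace, LinearMap.mem_range, Prod.exists, hmap, Submodule.mem_sup,
    Submodule.mem_span_pair]
  constructor
  · rintro ⟨a, c, d, rfl⟩
    exact ⟨_, ⟨a, rfl⟩, _, ⟨c, d, rfl⟩, rfl⟩
  · rintro ⟨_, ⟨a, rfl⟩, _, ⟨c, d, rfl⟩, rfl⟩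
    exact ⟨a, c, d, rfl⟩

end Twisted

section Coordinates

variable {K : Type u} [Field K] {U : Type v} [AddCommGroup U] [Module K U]
  {V : Type w} [AddCommGroup V] [Module K V] {A : Type v'} [AddCommGroup A] [Module K A]
  {f h : U →ₗ[K] V}

lemma bijective_add (hker : IsCompl (LinearMap.ker f) (LinearMap.ker h))
    (hrange : IsCompl (LinearMap.range f) (LinearMap.range h)) : Function.Bijective (f + h) := by
  constructor
  · refine (injective_iff_map_eq_zero _).2 fun w hw => ?_
    have hfh : f w = h (-w) := by rw [map_neg]; exact eq_neg_of_add_eq_zero_left hw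
    have hfw : f w = 0 := Submodule.disjoint_def.1 hrange.disjoint _ ⟨w, rfl⟩ ⟨-w, hfh.symm⟩
    have hhw : h w = 0 := by simpa [hfw] using hw
    exact Submodule.disjoint_def.1 hker.disjoint w hfw hhw
  · intro v
    have hv : v ∈ LinearMap.range f ⊔ LinearMap.range h := hrange.sup_eq_top ▸ Submodule.mem_top
    have hsplit : ∀ w, ∃ z ∈ LinearMap.ker f, ∃ z' ∈ LinearMap.ker h, z + z' = w := fun w =>
      Submodule.mem_sup.1 (hker.sup_eq_top ▸ Submodule.mem_top)
    obtain ⟨_, ⟨a, rfl⟩, _, ⟨b, rfl⟩, rfl⟩ := Submodule.mem_sup.1 hv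
    obtain ⟨z, hz, z', hz', rfl⟩ := hsplit a
    obtain ⟨y, hy, y', hy', rfl⟩ := hsplit b
    refine ⟨z' + y, ?_⟩
    simp_all

lemma exists_coordinates (hker : IsCompl (LinearMap.ker f) (LinearMap.ker h))
    (hrange : IsCompl (LinearMap.range f) (LinearMap.range h)) (e₁ : A ≃ₗ[K] LinearMap.ker h)
    (e₂ : A ≃ₗ[K] LinearMap.ker f) : ∃ (F : (A × A) ≃ₗ[K] U) (G : (A × A) ≃ₗ[K] V),
      (∀ y z, f (F (y, z)) = G (y, 0)) ∧ ∀ y z, h (F (y, z)) = G (0, z) := by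
  refine ⟨(e₁.prodCongr e₂).trans (Submodule.prodEquivOfIsCompl _ _ hker.symm),
    ((e₁.prodCongr e₂).trans (Submodule.prodEquivOfIsCompl _ _ hker.symm)).trans
      (LinearEquiv.ofBijective (f + h) (bijective_add hker hrange)), ?_, ?_⟩ <;>
  simp

lemma block_of_map_ker_eq_range {F : (A × A) ≃ₗ[K] U} {G : (A × A) ≃ₗ[K] V}
    (hf : ∀ y z, f (F (y, z)) = G (y, 0)) {q : U →ₗ[K] V}
    (hq : (LinearMap.ker f).map q = LinearMap.range f) {φ : A × A → A × A}
    (hφ : ∀ p, G (φ p) = q (F p)) :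
    (∀ z, (φ (0, z)).2 = 0) ∧ Function.Surjective fun z => (φ (0, z)).1 := by
  constructor
  · intro z
    have hz : q (F (0, z)) ∈ LinearMap.range f := by
      rw [← hq]
      exact Submodule.mem_map_of_mem (by simp [hf, ← Prod.zero_eq_mk])
    obtain ⟨w, hw⟩ := hz
    obtain ⟨⟨y', z'⟩, rfl⟩ := F.surjective w
    rw [← hφ, hf] at hw
    rw [← G.injective hw]
  · intro v
    have hv : G (v, 0) ∈ (LinearMap.ker f).map q := hq ▸ ⟨F (v, 0), hf v 0⟩
    obtain ⟨w, hw, hwv⟩ := hv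
    obtain ⟨⟨y, z⟩, rfl⟩ := F.surjective w
    obtain rfl : y = 0 := by simpa [hf] using hw
    exact ⟨z, congrArg Prod.fst (G.injective ((hφ _).trans hwv))⟩

lemma exists_equivalent_twistedOperatorSpace [FiniteDimensional K A]
    {F : (A × A) ≃ₗ[K] U} {G : (A × A) ≃ₗ[K] V} (hf : ∀ y z, f (F (y, z)) = G (y, 0))
    (hh : ∀ y z, h (F (y, z)) = G (0, z)) {Q : Submodule K (U →ₗ[K] V)} (eQ : A ≃ₗ[K] Q)
    (hQf : ∀ q ∈ Q, q ≠ 0 → (LinearMap.ker f).map q = LinearMap.range f)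
    (hQh : ∀ q ∈ Q, q ≠ 0 → (LinearMap.ker h).map q = LinearMap.range h) :
    ∃ star bullet : A →ₗ[K] A →ₗ[K] A, IsRegular star ∧ IsRegular bullet ∧
      Equivalent (Q ⊔ Submodule.span K {f, h}) (twistedOperatorSpace star bullet) := by
  let E : ((A × A) →ₗ[K] (A × A)) ≃ₗ[K] (U →ₗ[K] V) := LinearEquiv.arrowCongr F G
  let ψ : A →ₗ[K] (A × A) →ₗ[K] (A × A) := E.symm.toLinearMap ∘ₗ Q.subtype ∘ₗ eQ.toLinearMap
  have hψ : ∀ a p, G (ψ a p) = (eQ a : U →ₗ[K] V) (F p) := fun a p => by simp [ψ, E]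
  have heQ : ∀ a, a ≠ 0 → (eQ a : U →ₗ[K] V) ≠ 0 := fun a ha => by simpa using ha
  have hupper : ∀ a, a ≠ 0 →
      (∀ z, (ψ a (0, z)).2 = 0) ∧ Function.Surjective fun z => (ψ a (0, z)).1 := fun a ha =>
    block_of_map_ker_eq_range hf (hQf _ (eQ a).2 (heQ a ha)) (hψ a)
  have hlower : ∀ a, a ≠ 0 →
      (∀ y, (ψ a (y, 0)).1 = 0) ∧ Function.Surjective fun y => (ψ a (y, 0)).2 := fun a ha =>
    block_of_map_ker_eq_range (F := (LinearEquiv.prodComm K A A).trans F)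
      (G := (LinearEquiv.prodComm K A A).trans G) (φ := fun p => (ψ a p.swap).swap)
      (fun y z => hh z y) (hQh _ (eQ a).2 (heQ a ha)) (fun p => hψ a p.swap)
  refine ⟨upperRightBlock ψ, lowerLeftBlock ψ, isRegular_of_surjective fun a ha => (hupper a ha).2,
    isRegular_of_surjective fun a ha => (hlower a ha).2, equivalent_iff.2 ⟨F, G, ?_⟩⟩
  have hEf : E (LinearMap.inl K A A ∘ₗ LinearMap.fst K A A) = f := LinearMap.ext fun w => by
    obtain ⟨⟨y, z⟩, rfl⟩ := F.surjective w
    simp [E, hf]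
  have hEh : E (LinearMap.inr K A A ∘ₗ LinearMap.snd K A A) = h := LinearMap.ext fun w => by
    obtain ⟨⟨y, z⟩, rfl⟩ := F.surjective w
    simp [E, hh]
  have hEψ : (LinearMap.range ψ).map E.toLinearMap = Q := by
    have hcomp : E.toLinearMap ∘ₗ ψ = Q.subtype ∘ₗ eQ.toLinearMap :=
      LinearMap.ext fun a => E.apply_symm_apply _
    rw [← LinearMap.range_comp, hcomp, LinearEquiv.range_comp, Submodule.range_subtype]
  rw [twistedOperatorSpace_blocks, Submodule.map_sup, hEψ, Submodule.map_span, Set.image_pair,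
    LinearEquiv.coe_coe, hEf, hEh]
  · intro a z
    by_cases ha : a = 0
    · simp [ha]
    · exact (hupper a ha).1 z
  · intro a y
    by_cases ha : a = 0
    · simp [ha]
    · exact (hlower a ha).1 y

lemma IsAnnihilatorPair.exists_equivalent_twistedOperatorSpace [FiniteDimensional K U]
    [FiniteDimensional K A] {T : Submodule K (U →ₗ[K] V)} [FiniteDimensional K T] {x y : U}
    (hp : IsAnnihilatorPair T x y f h) (hK : (finrank K T : Cardinal.{u}) < Cardinal.mk K)
    (h3 : 3 ≤ finrank K T)
    (hrank : ∀ t ∈ T, t ≠ 0 → 2 * finrank K T - 2 ≤ finrank K (LinearMap.range t))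
    (hT : IsReduced T) (hA : finrank K A + 1 = finrank K T) :
    ∃ star bullet : A →ₗ[K] A →ₗ[K] A, IsRegular star ∧ IsRegular bullet ∧
      Equivalent (T ⊔ (K ∙ f)) (twistedOperatorSpace star bullet) := by
  have hQ := hp.finrank_offDiagonal hK h3 hrank
  have hkerf := hp.finrank_ker_add_one hK h3 hrank hT.1
  have hkerh := hp.symm.finrank_ker_add_one hK h3 hrank hT.1
  have : FiniteDimensional K (offDiagonal T x y f h) :=
    Submodule.finiteDimensional_of_le fun q hq => (mem_offDiagonal.1 hq).1
  obtain ⟨F, G, hf, hh⟩ := exists_coordinates (hp.isCompl_ker hK h3 hrank hT.1)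
    (hp.isCompl_range hK h3 hrank hT) (LinearEquiv.ofFinrankEq A _ (by omega))
    (LinearEquiv.ofFinrankEq A _ (by omega))
  rw [← hp.offDiagonal_sup_span hK h3 hrank]
  exact OperatorSpace.exists_equivalent_twistedOperatorSpace hf hh
    (LinearEquiv.ofFinrankEq A (offDiagonal T x y f h) (by omega))
    (fun _ => hp.map_ker_eq_range hK h3 hrank)
    (fun _ hq => hp.symm.map_ker_eq_range hK h3 hrank (hp.offDiagonal_comm ▸ hq))

end Coordinates

end OperatorSpace

open OperatorSpace Module in
theorem corollary6p3
    {K : Type u} [Field K]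
    {U : Type v} [AddCommGroup U] [Module K U] [FiniteDimensional K U]
    {V : Type w} [AddCommGroup V] [Module K V] [FiniteDimensional K V]
    (n : ℕ) (hn : 3 ≤ n) (hK : (n : Cardinal.{u}) < Cardinal.mk K)
    (T : Submodule K (U →ₗ[K] V))
    (hdim : Module.finrank K T = n)
    (hred : OperatorSpace.IsReduced T)
    (hnonrefl : ¬ OperatorSpace.IsReflexive T)
    (hrank : ∀ f ∈ T, f ≠ 0 → 2 * n - 2 ≤ Module.finrank K (LinearMap.range f)) :
    ∃ (A : Type u) (_ : AddCommGroup A) (_ : Module K A) (star bullet : A →ₗ[K] A →ₗ[K] A),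
      OperatorSpace.IsLDBDivisionAlgebra star bullet ∧
      Module.finrank K A = n - 1 ∧
      ∃ H : Submodule K ((A × A) →ₗ[K] (A × A)),
        OperatorSpace.IsHyperplaneOf H (OperatorSpace.twistedOperatorSpace star bullet) ∧
        OperatorSpace.Equivalent T H := by
  subst hdim
  obtain ⟨x, y, f, h, hp⟩ := exists_isAnnihilatorPair hK
    (exists_isSeparatingVector hK fun t ht ht0 => le_trans (by omega) (hrank t ht ht0)) hnonrefl
  have hA : finrank K (Fin (finrank K T - 1) → K) = finrank K T - 1 := finrank_fin_fun K
  obtain ⟨star, bullet, hstar, hbullet, hequiv⟩ :=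
    hp.exists_equivalent_twistedOperatorSpace hK hn hrank hred (by rw [hA]; omega)
  refine ⟨_, _, _, star, bullet, ⟨inferInstance, ?_, hstar, ?_⟩, hA, ?_⟩
  · exact nontrivial_of_finrank_pos (R := K) (by omega)
  · exact hequiv.isQuasiLeftInversion hp.left.mem_reflexiveClosure hp.notMem hbullet
  · exact hequiv.exists_isHyperplaneOf (isHyperplaneOf_sup_span_singleton hp.notMem)
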